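/- For a positive integer $n$, let $T_n$ be the rooted infinite complete $n$-ary tree, and assign to its edges independent labels, each uniformly distributed on $[0,1]$. Give every vertex other than the root the label of the edge joining it to its parent, and give the root the label $p$. The $p$-percolated uniform temporal tree $\mathcal{T}_{n,p}$ is obtained from $T_n$ by keeping exactly those vertices $v$ for which the vertex labels are decreasing along the path from the root to $v$. Let $|\mathcal{T}_{n,p}|$ be the number of its vertices and $H_{n,p}$ its height, that is, the maximal distance of a vertex of $\mathcal{T}_{n,p}$ from the root. Theorem. Fix $p\in(0,1]$. Then $\mathcal{T}_{n,p}$ is almost surely finite for every $n$ (so that $|\mathcal{T}_{n,p}|$ and $H_{n,p}$ are well defined almost surely), and $$\frac{H_{n,p}}{np}\longrightarrow e \qquad\text{and}\qquad \frac{H_{n,p}}{\log|\mathcal{T}_{n,p}|}\longrightarrow e$$ in probability as $n\to\infty$. -/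

import Mathlib

open MeasureTheory ProbabilityTheory Filter Topology

namespace TemporalTree

/-- The vertices of the rooted infinite complete `n`-ary tree. The root is `[]`, and the children of
`v` are the `n` vertices `i :: v`; so the vertices on the path from `v` up to the root are the
members of `v.tails`, in this order. -/
abbrev Vertex (n : ℕ) : Type := List (Fin n)

/-- The depth of a vertex: its distance from the root. -/
def depth {n : ℕ} (v : Vertex n) : ℕ := v.length

/-- The edges of the complete `n`-ary tree: `(v, i)` is the edge between `v` and its child
`i :: v`. -/
abbrev Edge (n : ℕ) : Type := Vertex n × Fin n

/-- The vertex labels that belong to the edge labels `u`: the root has label `p`, any other vertex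
has the label of the edge to its parent. -/
def label {n : ℕ} (p : ℝ) (u : Edge n → ℝ) : Vertex n → ℝ
  | [] => p
  | i :: v => u (v, i)

/-- The vertex set of the `p`-percolated temporal tree with edge labels `u`: the vertices `v` such
that the vertex labels decrease along the path from the root to `v` (that is, they increase along
the path from `v` to the root). -/
def tree {n : ℕ} (p : ℝ) (u : Edge n → ℝ) : Set (Vertex n) :=
  {v | v.tails.IsChain (fun w w' => label p u w < label p u w')}

theorem nil_mem_tree {n : ℕ} (p : ℝ) (u : Edge n → ℝ) : ([] : Vertex n) ∈ tree p u := by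
  simp [tree]

theorem cons_mem_tree {n : ℕ} (p : ℝ) (u : Edge n → ℝ) (i : Fin n) (v : Vertex n) :
    i :: v ∈ tree p u ↔ u (v, i) < label p u v ∧ v ∈ tree p u := by
  cases v <;> simp [tree, label]

/-- The number of vertices of the tree (meaningful when the tree is finite). -/
noncomputable def size {n : ℕ} (p : ℝ) (u : Edge n → ℝ) : ℕ := (tree p u).ncard

/-- The height of the tree: the maximal depth of its vertices (meaningful when the tree is
finite). -/
noncomputable def height {n : ℕ} (p : ℝ) (u : Edge n → ℝ) : ℕ := sSup (depth '' tree p u)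

/-- Convergence in probability to a constant, for random variables `X n` each of which may be
defined on a probability space of its own. -/
def TendstoInProbability {Ω : ℕ → Type*} [∀ n, MeasurableSpace (Ω n)] (P : ∀ n, Measure (Ω n))
    (X : ∀ n, Ω n → ℝ) (c : ℝ) : Prop :=
  ∀ ε : ℝ, 0 < ε → Tendsto (fun n => P n {ω | ε ≤ |X n ω - c|}) atTop (𝓝 0)

end TemporalTree

/-! Write `Z_k(x)` for the number of vertices at depth `k` when the root has label `x`. The subtree
at a child with label `y < x` is a percolated tree with root label `y`, independent of its siblings
(`measurePreserving_split`).

Upper bounds are first moments: `E Z_k(p) = (np)^k / k!`, which becomes exponentially small once `k`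
exceeds `e np` by a constant factor, and the sum over `k` is `E|T| = e^(np)`. Markov's inequality
then bounds both the height and `log |T|`, and gives almost sure finiteness.

For the lower bounds, mark vertices at depth `k` independently with probability `θ` and let `h_k(x)`
be the probability that a mark occurs. Then `h_0 = θ` and `h_{k+1}(x) = 1 - (1 - ∫_0^x h_k)^n`,
which is nearly `n ∫_0^x h_k` while this is small. So raising the root label by `l/n` and the depth
by `k` multiplies the bound on `h` by about `l^k / k!`. With `l = k/b` and `k` large this is at
least `(c/b)^k` for any `c < e`, because `k^k / k!` is `e^k` up to a polynomial factor. After `m`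
such blocks `h` is at least a constant `q` if `θ = q (c/b)^(-km)`; one more generation, with many
children at the root, makes a mark very likely. As `s` vertices carry a mark with probability at
most `sθ`, the level then has many vertices (`exists_measureReal_levelCount_le`). Taking `b = c`
close to `e` reaches depth near `e np`; taking `b = 1` gives about `e^(np)` vertices near depth
`np`. -/

namespace TemporalTree

/-! ### Decomposition of the tree at the root -/

section Percolation

variable {n : ℕ}

/-- The edge labels that the subtree rooted at the child `[i]` of the root inherits from `u`. -/
def subLabels (i : Fin n) (u : Edge n → ℝ) : Edge n → ℝ := fun e => u (e.1 ++ [i], e.2)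

/-- Lists record the path from the vertex up to the root, so the last entry names the child of the
root. Unlike `cons_mem_tree`, which adds a leaf, this splits at the root, where the subtrees are
independent. -/
theorem append_singleton_mem_tree (x : ℝ) (u : Edge n → ℝ) (i : Fin n) (v : Vertex n) :
    v ++ [i] ∈ tree x u ↔ u ([], i) < x ∧ v ∈ tree (u ([], i)) (subLabels i u) := by
  induction v with
  | nil => simp [cons_mem_tree, nil_mem_tree, label]
  | cons j w ih =>
    have h : label x u (w ++ [i]) = label (u ([], i)) (subLabels i u) w := by
      cases w <;> rfl
    rw [List.cons_append, cons_mem_tree, ih, cons_mem_tree, h]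
    change (subLabels i u (w, j) < _ ∧ _) ↔ _
    tauto

open Classical in
/-- The vertices at depth `k` of the percolated temporal tree whose root has label `x`. -/
noncomputable def level : ℕ → ℝ → (Edge n → ℝ) → Finset (Vertex n)
  | 0, _, _ => {[]}
  | k + 1, x, u => Finset.univ.biUnion fun i =>
      if u ([], i) < x then (level k (u ([], i)) (subLabels i u)).image (· ++ [i]) else ∅

theorem mem_level {k : ℕ} {x : ℝ} {u : Edge n → ℝ} {v : Vertex n} :
    v ∈ level k x u ↔ v ∈ tree x u ∧ depth v = k := by
  induction k generalizing x u v with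
  | zero =>
    simp only [level, Finset.mem_singleton, depth, List.length_eq_zero_iff]
    exact ⟨fun h => ⟨h ▸ nil_mem_tree x u, h⟩, fun h => h.2⟩
  | succ k ih =>
    simp only [level, Finset.mem_biUnion, Finset.mem_univ, true_and]
    constructor
    · rintro ⟨i, hi⟩
      split_ifs at hi with hx
      · obtain ⟨w, hw, rfl⟩ := Finset.mem_image.1 hi
        obtain ⟨hw, hd⟩ := ih.1 hw
        exact ⟨(append_singleton_mem_tree x u i w).2 ⟨hx, hw⟩, by simpa [depth] using hd⟩
      · simp at hi
    · rintro ⟨hv, hd⟩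
      rcases List.eq_nil_or_concat v with rfl | ⟨w, i, rfl⟩
      · simp [depth] at hd
      · rw [List.concat_eq_append] at hv hd ⊢
        obtain ⟨hx, hw⟩ := (append_singleton_mem_tree x u i w).1 hv
        refine ⟨i, ?_⟩
        rw [if_pos hx]
        exact Finset.mem_image_of_mem _ (ih.2 ⟨hw, by simpa [depth] using hd⟩)

/-- The number of vertices at depth `k`. -/
noncomputable def levelCount (k : ℕ) (x : ℝ) (u : Edge n → ℝ) : ℕ := (level k x u).card

theorem levelCount_zero (x : ℝ) (u : Edge n → ℝ) : levelCount 0 x u = 1 := by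
  simp [levelCount, level]

/-- A vertex below the child `[i]` is a list ending in `i`, so different children contribute
disjoint sets. -/
theorem levelCount_succ (k : ℕ) (x : ℝ) (u : Edge n → ℝ) :
    levelCount (k + 1) x u =
      ∑ i, if u ([], i) < x then levelCount k (u ([], i)) (subLabels i u) else 0 := by
  classical
  rw [levelCount, level, Finset.card_biUnion]
  · refine Finset.sum_congr rfl fun i _ => ?_
    split_ifs
    · exact Finset.card_image_of_injective _ (List.append_left_injective _)
    · simp
  · intro i _ j _ hij
    rw [Function.onFun, Finset.disjoint_left]
    intro v hv hv'
    split_ifs at hv hv' <;> simp only [Finset.mem_image, Finset.notMem_empty] at hv hv'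
    obtain ⟨w, -, rfl⟩ := hv
    obtain ⟨w', -, h⟩ := hv'
    exact hij (by simpa using (List.append_inj_right' h rfl).symm)

@[fun_prop]
theorem measurable_subLabels (i : Fin n) : Measurable (subLabels i) := by
  unfold subLabels
  fun_prop

/-- Joint measurability is needed because the root label of a subtree is itself one of the random
edge labels. -/
theorem measurable_levelCount (k : ℕ) :
    Measurable fun z : ℝ × (Edge n → ℝ) => levelCount k z.1 z.2 := by
  induction k with
  | zero => simp only [levelCount_zero]; fun_prop
  | succ k ih =>
    simp only [levelCount_succ]
    refine Finset.measurable_sum _ fun i _ => Measurable.ite ?_ ?_ measurable_const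
    · exact measurableSet_lt (by fun_prop) (by fun_prop)
    · exact ih.comp (f := fun z : ℝ × (Edge n → ℝ) => (z.2 ([], i), subLabels i z.2)) (by fun_prop)

theorem measurable_levelCount_right (k : ℕ) (x : ℝ) :
    Measurable fun u : Edge n → ℝ => levelCount k x u :=
  (measurable_levelCount k).comp (f := fun u : Edge n → ℝ => (x, u)) (by fun_prop)

/-! ### Law of the labels and independence of the subtrees -/

/-- The uniform distribution on `[0, 1]`. -/
noncomputable abbrev unif : Measure ℝ := volume.restrict (Set.Icc (0 : ℝ) 1)

instance isProbabilityMeasure_unif : IsProbabilityMeasure unif := ⟨by simp [unif]⟩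

/-- The law of independent uniform edge labels. -/
noncomputable def labelLaw (n : ℕ) : Measure (Edge n → ℝ) := Measure.infinitePi fun _ => unif

instance isProbabilityMeasure_labelLaw (n : ℕ) : IsProbabilityMeasure (labelLaw n) := by
  unfold labelLaw; infer_instance

/-- The product measure indexed by `Option ι` splits off the coordinate `none`. -/
theorem measurePreserving_infinitePi_option {ι X : Type*} [MeasurableSpace X] (ν : Measure X)
    [IsProbabilityMeasure ν] :
    MeasurePreserving (fun (z : X × (ι → X)) (o : Option ι) => o.elim z.1 z.2)
      (ν.prod (Measure.infinitePi fun _ => ν)) (Measure.infinitePi fun _ => ν) := by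
  have hm : Measurable (fun (z : X × (ι → X)) (o : Option ι) => o.elim z.1 z.2) := by
    refine measurable_pi_lambda _ fun o => ?_
    cases o <;> simp only [Option.elim] <;> fun_prop
  refine ⟨hm, Measure.eq_infinitePi _ fun s t ht => ?_⟩
  classical
  rw [Measure.map_apply hm (MeasurableSet.pi s.countable_toSet fun i _ => ht i)]
  have hset : (fun (z : X × (ι → X)) (o : Option ι) => o.elim z.1 z.2) ⁻¹' (s : Set (Option ι)).pi t
      = (if none ∈ s then t none else Set.univ) ×ˢ
        ((s.eraseNone : Set ι).pi fun i => t (some i)) := by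
    ext ⟨y, w⟩
    by_cases h : none ∈ s <;> simp [h, Set.mem_pi, Option.forall]
  rw [hset, Measure.prod_prod, Measure.infinitePi_pi _ (fun i _ => ht _)]
  have himg : ∏ i ∈ s.eraseNone, ν (t (some i)) = ∏ o ∈ s.erase none, ν (t o) := by
    rw [← Finset.map_some_eraseNone, Finset.prod_map]
    rfl
  rw [himg]
  split_ifs with h
  · exact Finset.mul_prod_erase s (fun o => ν (t o)) h
  · rw [measure_univ, one_mul, Finset.erase_eq_of_notMem h]

/-- The labels of the edges at the root and of the subtrees at its children are independent, and
each of these subtrees is labelled like the whole tree. -/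
theorem measurePreserving_split (n : ℕ) :
    MeasurePreserving (fun (u : Edge n → ℝ) (i : Fin n) => (u ([], i), subLabels i u))
      (labelLaw n) (Measure.pi fun _ => unif.prod (labelLaw n)) := by
  -- The pair `(i, none)` stands for the edge from the root to `[i]`, and `(i, some e)` for the edge
  -- `e` of the subtree there.
  let f : Fin n × Option (Edge n) → Edge n := fun a => a.2.elim ([], a.1) fun e => (e.1 ++ [a.1], e.2)
  have hf : Function.Injective f := by
    rintro ⟨i, _ | ⟨v, j⟩⟩ ⟨i', _ | ⟨v', j'⟩⟩ h <;> simp [f] at h ⊢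
    · exact h
    · obtain ⟨⟨h1, h2⟩, h3⟩ := h
      exact ⟨h2, h1, h3⟩
  let g : (Option (Edge n) → ℝ) → ℝ × (Edge n → ℝ) := fun w => (w none, fun e => w (some e))
  have hg : Measurable g := by fun_prop
  have h1 := Measure.map_infinitePi_infinitePi_of_inj (P := fun _ : Edge n => unif) hf
  have h2 := Measure.infinitePi_map_curry (fun (_ : Fin n) (_ : Option (Edge n)) => unif)
  have h3 : Measure.map g (Measure.infinitePi fun _ => unif) = unif.prod (labelLaw n) := by
    have h := measurePreserving_infinitePi_option (ι := Edge n) unif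
    rw [← h.map_eq, Measure.map_map hg h.measurable]
    exact Measure.map_id
  have h4 := Measure.infinitePi_map_pi (μ := fun _ : Fin n => Measure.infinitePi fun _ : Option (Edge n) => unif)
    (f := fun _ => g) fun _ => hg
  refine ⟨by fun_prop, ?_⟩
  rw [← Measure.infinitePi_eq_pi, ← h3, ← h4, ← h2, ← h1]
  rw [Measure.map_map (by fun_prop) (by fun_prop), Measure.map_map (by fun_prop) (by fun_prop)]
  rfl

/-! ### Hitting probabilities and their recursion -/

/-- The probability that some vertex at depth `k` is marked, if each vertex is marked
independently with probability `θ` and the root has label `x`. -/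
noncomputable def hitProb (n : ℕ) (θ : ℝ) (k : ℕ) (x : ℝ) : ℝ :=
  1 - ∫ u, (1 - θ) ^ levelCount k x u ∂labelLaw n

theorem measurable_pow_levelCount (θ : ℝ) (k : ℕ) :
    Measurable fun z : ℝ × (Edge n → ℝ) => (1 - θ) ^ levelCount k z.1 z.2 :=
  (measurable_from_top (f := fun m : ℕ => (1 - θ) ^ m)).comp (measurable_levelCount k)

theorem integrable_of_mem_Icc {Ω : Type*} [MeasurableSpace Ω] {μ : Measure Ω} [IsFiniteMeasure μ]
    {f : Ω → ℝ} (hf : Measurable f) (h0 : ∀ ω, 0 ≤ f ω) (h1 : ∀ ω, f ω ≤ 1) : Integrable f μ :=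
  Integrable.of_bound hf.aestronglyMeasurable 1
    (.of_forall fun ω => by rw [Real.norm_of_nonneg (h0 ω)]; exact h1 ω)

theorem hitProb_zero (θ x : ℝ) : hitProb n θ 0 x = θ := by
  simp [hitProb, levelCount_zero]

theorem measurable_hitProb (θ : ℝ) (k : ℕ) : Measurable (hitProb n θ k) :=
  measurable_const.sub
    (measurable_pow_levelCount θ k).stronglyMeasurable.integral_prod_right.measurable

theorem hitProb_le_one {θ : ℝ} (h1 : θ ≤ 1) (k : ℕ) (x : ℝ) : hitProb n θ k x ≤ 1 := by
  have : 0 ≤ ∫ u, (1 - θ) ^ levelCount k x u ∂labelLaw n :=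
    integral_nonneg fun u => pow_nonneg (by linarith) _
  rw [hitProb]
  linarith

section

variable {θ : ℝ} (h0 : 0 ≤ θ) (h1 : θ ≤ 1)
include h0 h1

theorem integrable_pow_levelCount (k : ℕ) (x : ℝ) :
    Integrable (fun u => (1 - θ) ^ levelCount k x u) (labelLaw n) :=
  integrable_of_mem_Icc
    ((measurable_pow_levelCount θ k).comp (f := fun u : Edge n → ℝ => (x, u)) (by fun_prop))
    (fun _ => pow_nonneg (by linarith) _) fun _ => pow_le_one₀ (by linarith) (by linarith)

theorem hitProb_nonneg (k : ℕ) (x : ℝ) : 0 ≤ hitProb n θ k x := by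
  have := integral_mono (integrable_pow_levelCount (n := n) h0 h1 k x) (integrable_const (1 : ℝ))
    fun u => pow_le_one₀ (by linarith) (by linarith)
  simp only [integral_const, probReal_univ, one_smul] at this
  rw [hitProb]
  linarith

theorem integrable_indicator_hitProb (k : ℕ) (x : ℝ) :
    Integrable ((Set.Iio x).indicator (hitProb n θ k)) unif :=
  (integrable_of_mem_Icc (measurable_hitProb θ k) (hitProb_nonneg h0 h1 k)
    (hitProb_le_one h1 k)).indicator measurableSet_Iio

/-- A vertex at depth `k + 1` is a vertex at depth `k` of the subtree at one of the `n` children. -/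
theorem hitProb_succ (k : ℕ) (x : ℝ) :
    hitProb n θ (k + 1) x = 1 - (1 - ∫ y, (Set.Iio x).indicator (hitProb n θ k) y ∂unif) ^ n := by
  let F : ℝ × (Edge n → ℝ) → ℝ := fun z =>
    if z.1 < x then (1 - θ) ^ levelCount k z.1 z.2 else 1
  have hF : Measurable F :=
    Measurable.ite (measurableSet_lt (by fun_prop) (by fun_prop)) (measurable_pow_levelCount θ k)
      measurable_const
  have hFi : Integrable F (unif.prod (labelLaw n)) := by
    refine integrable_of_mem_Icc hF (fun z => ?_) fun z => ?_ <;> simp only [F] <;> split_ifs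
    · exact pow_nonneg (by linarith) _
    · exact zero_le_one
    · exact pow_le_one₀ (by linarith) (by linarith)
    · exact le_rfl
  -- Absence of marks factors over the children of the root; a child with label at least `x` is not
  -- in the tree and contributes the factor `1`.
  have hpow : ∀ u : Edge n → ℝ, (1 - θ) ^ levelCount (k + 1) x u =
      ∏ i, F (u ([], i), subLabels i u) := fun u => by
    rw [levelCount_succ, ← Finset.prod_pow_eq_pow_sum]
    refine Finset.prod_congr rfl fun i _ => ?_
    simp only [F]
    split_ifs <;> simp
  have hint : ∫ u, (1 - θ) ^ levelCount (k + 1) x u ∂labelLaw n =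
      (∫ z, F z ∂unif.prod (labelLaw n)) ^ n := by
    simp_rw [hpow]
    have hs := measurePreserving_split n
    have := integral_map (μ := labelLaw n) hs.measurable.aemeasurable
      (f := fun w : Fin n → ℝ × (Edge n → ℝ) => ∏ i, F (w i))
      (Measurable.aestronglyMeasurable (by fun_prop))
    rw [hs.map_eq] at this
    rw [← this, integral_fintype_prod_eq_prod (fun _ => F)]
    simp
  have hsect : ∫ z, F z ∂unif.prod (labelLaw n) =
      1 - ∫ y, (Set.Iio x).indicator (hitProb n θ k) y ∂unif := by
    rw [integral_prod _ hFi]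
    have : ∀ y, ∫ u, F (y, u) ∂labelLaw n = 1 - (Set.Iio x).indicator (hitProb n θ k) y := by
      intro y
      by_cases h : y < x <;> simp [F, h, hitProb]
    simp_rw [this]
    rw [integral_sub (integrable_const _) (integrable_indicator_hitProb h0 h1 k x)]
    simp
  rw [hitProb, hint, hsect]

/-- A lower bound `φ` for the hitting probability on `[a, x]` passes to the next depth. -/
theorem le_hitProb_succ {k : ℕ} {a x : ℝ} (ha : 0 ≤ a) (hax : a ≤ x) (hx : x ≤ 1) {φ : ℝ → ℝ}
    (hφi : IntervalIntegrable φ volume a x)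
    (hφ : ∀ y, a ≤ y → y ≤ x → φ y ≤ hitProb n θ k y) :
    1 - (1 - ∫ y in a..x, φ y) ^ n ≤ hitProb n θ (k + 1) x := by
  have hle : ∫ y in a..x, φ y ≤ ∫ y, (Set.Iio x).indicator (hitProb n θ k) y ∂unif := by
    rw [intervalIntegral.integral_of_le hax, integral_Ioc_eq_integral_Ioo,
      ← integral_indicator measurableSet_Ioo, ← integral_indicator measurableSet_Icc]
    refine integral_mono ?_ ?_ fun y => ?_
    · exact ((intervalIntegrable_iff_integrableOn_Ioo_of_le hax).1 hφi).integrable_indicator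
        measurableSet_Ioo
    · exact IntegrableOn.integrable_indicator (integrable_indicator_hitProb h0 h1 k x)
        measurableSet_Icc
    · by_cases hy : y ∈ Set.Ioo a x
      · have hy' : y ∈ Set.Icc (0 : ℝ) 1 := ⟨ha.trans hy.1.le, hy.2.le.trans hx⟩
        rw [Set.indicator_of_mem hy, Set.indicator_of_mem hy',
          Set.indicator_of_mem (Set.mem_Iio.2 hy.2)]
        exact hφ y hy.1.le hy.2.le
      · rw [Set.indicator_of_notMem hy]
        exact Set.indicator_nonneg (fun _ _ =>
          Set.indicator_nonneg (fun _ _ => hitProb_nonneg h0 h1 k _) _) _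
  -- This keeps the base of the `n`-th power nonnegative, so that the power is monotone in it.
  have hle1 : ∫ y, (Set.Iio x).indicator (hitProb n θ k) y ∂unif ≤ 1 := by
    have := integral_mono (integrable_indicator_hitProb (n := n) h0 h1 k x)
      (integrable_const (1 : ℝ)) fun y => Set.indicator_le' (fun y _ => hitProb_le_one h1 k y)
        (fun _ _ => zero_le_one) y
    simpa using this
  rw [hitProb_succ h0 h1]
  gcongr

/-- A vertex count at most `s` is unlikely if some vertex is likely to be marked. -/
theorem measureReal_levelCount_le (k : ℕ) (x : ℝ) {s : ℝ} (hs : 0 ≤ s) :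
    (labelLaw n).real {u | (levelCount k x u : ℝ) ≤ s} ≤ 1 - hitProb n θ k x + s * θ := by
  have hm : MeasurableSet {u : Edge n → ℝ | (levelCount k x u : ℝ) ≤ s} :=
    measurableSet_le ((measurable_from_top (f := fun m : ℕ => (m : ℝ))).comp
      (measurable_levelCount_right k x)) measurable_const
  have hi := integrable_pow_levelCount (n := n) h0 h1 k x
  -- By Bernoulli's inequality `(1 - θ) ^ Z ≥ 1 - Z θ`, so `1 ≤ (1 - θ) ^ Z + s θ` wherever `Z ≤ s`.
  have := integral_mono (μ := labelLaw n) ((integrable_const (1 : ℝ)).indicator hm)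
    (hi.add (integrable_const (s * θ))) fun u => by
      refine Set.indicator_apply_le' (fun hu => ?_) fun _ => ?_
      · have hb := one_add_mul_le_pow (a := -θ) (by linarith) (levelCount k x u)
        have : (levelCount k x u : ℝ) * θ ≤ s * θ := mul_le_mul_of_nonneg_right hu h0
        simp only [Pi.add_apply]
        rw [← sub_eq_add_neg] at hb
        linarith
      · exact add_nonneg (pow_nonneg (by linarith) _) (mul_nonneg hs h0)
  rw [integral_indicator_const _ hm, integral_add' hi (integrable_const _)] at this
  simp only [smul_eq_mul, mul_one, integral_const, probReal_univ, one_mul] at this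
  rw [hitProb]
  linarith

end

/-! ### First moment of a level -/

/-- The expected number of vertices at depth `k`. -/
theorem lintegral_levelCount (k : ℕ) {x : ℝ} (hx0 : 0 ≤ x) (hx1 : x ≤ 1) :
    ∫⁻ u, (levelCount k x u : ENNReal) ∂labelLaw n =
      ENNReal.ofReal ((n * x) ^ k / k.factorial) := by
  induction k generalizing x with
  | zero => simp [levelCount_zero]
  | succ k ih =>
    let G : ℝ × (Edge n → ℝ) → ENNReal := fun z =>
      if z.1 < x then (levelCount k z.1 z.2 : ENNReal) else 0
    have hG : Measurable G :=
      Measurable.ite (measurableSet_lt (by fun_prop) (by fun_prop))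
        ((measurable_from_top (f := fun m : ℕ => (m : ENNReal))).comp (measurable_levelCount k))
        measurable_const
    have hsum : ∀ u : Edge n → ℝ, (levelCount (k + 1) x u : ENNReal) =
        ∑ i, G (u ([], i), subLabels i u) := fun u => by
      rw [levelCount_succ, Nat.cast_sum]
      refine Finset.sum_congr rfl fun i _ => ?_
      simp only [G]
      split_ifs <;> simp
    have hone : ∀ i : Fin n, ∫⁻ u, G (u ([], i), subLabels i u) ∂labelLaw n =
        ∫⁻ z, G z ∂unif.prod (labelLaw n) := fun i =>
      ((measurePreserving_eval (fun _ => unif.prod (labelLaw n)) i).comp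
        (measurePreserving_split n)).lintegral_comp hG
    have hz : ∫⁻ z, G z ∂unif.prod (labelLaw n) =
        ENNReal.ofReal (∫ y in (0 : ℝ)..x, (n * y) ^ k / k.factorial) := by
      rw [lintegral_prod _ hG.aemeasurable, intervalIntegral.integral_of_le hx0,
        integral_Ioc_eq_integral_Ioo, ofReal_integral_eq_lintegral_ofReal
          ((Continuous.integrableOn_Icc (by fun_prop)).mono_set Set.Ioo_subset_Icc_self),
        ← lintegral_indicator measurableSet_Icc, ← lintegral_indicator measurableSet_Ioo]
      · refine lintegral_congr_ae ?_
        filter_upwards [Measure.ae_ne volume (0 : ℝ)] with y hy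
        by_cases h : y < x
        · by_cases h' : 0 ≤ y
          · rw [Set.indicator_of_mem (show y ∈ Set.Icc (0 : ℝ) 1 from ⟨h', h.le.trans hx1⟩),
              Set.indicator_of_mem (show y ∈ Set.Ioo 0 x from ⟨lt_of_le_of_ne h' hy.symm, h⟩)]
            simp only [G, h, if_true]
            exact ih h' (h.le.trans hx1)
          · rw [Set.indicator_of_notMem (fun hy => h' hy.1),
              Set.indicator_of_notMem (fun hy => h' hy.1.le)]
        · rw [Set.indicator_of_notMem (fun hy : y ∈ Set.Ioo 0 x => h hy.2)]
          refine Set.indicator_apply_eq_zero.2 fun _ => ?_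
          simp [G, h]
      · filter_upwards [ae_restrict_mem measurableSet_Ioo] with y hy
        have := hy.1.le
        positivity
    simp_rw [hsum]
    rw [lintegral_finsetSum _ fun i _ => by fun_prop]
    simp_rw [hone, hz]
    rw [Finset.sum_const, Finset.card_univ, Fintype.card_fin, nsmul_eq_mul,
      ← ENNReal.ofReal_natCast, ← ENNReal.ofReal_mul (by positivity)]
    congr 1
    simp_rw [mul_pow, mul_div_right_comm]
    rw [intervalIntegral.integral_const_mul, integral_pow, Nat.factorial_succ]
    push_cast
    field_simp
    ring

/-! ### Growth of the hitting probability -/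

/-- The recursion is linear up to a factor `1 - δ` while `J ≤ δ`: `(1 - J/n)^n ≤ e^(-J) ≤ 1/(1 + J)
≤ 1 - J + J^2`. -/
theorem mul_le_one_sub_one_sub_div_pow {δ J : ℝ} (hn : 0 < n) (hJ : 0 ≤ J) (hJδ : J ≤ δ)
    (hδ : δ ≤ 1) : (1 - δ) * J ≤ 1 - (1 - J / n) ^ n := by
  have h1 : (1 - J / n) ^ n ≤ Real.exp (-J) :=
    Real.one_sub_div_pow_le_exp_neg (hJδ.trans (hδ.trans (by exact_mod_cast hn)))
  have h2 : Real.exp (-J) ≤ 1 / (1 + J) := by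
    rw [Real.exp_neg, ← one_div]
    exact one_div_le_one_div_of_le (by linarith) (by linarith [Real.add_one_le_exp J])
  have h3 : 1 / (1 + J) ≤ 1 - (1 - J) * J := by
    rw [div_le_iff₀ (by linarith)]
    nlinarith [pow_nonneg hJ 3]
  nlinarith

section

variable {θ : ℝ} (h0 : 0 ≤ θ) (h1 : θ ≤ 1)
include h0 h1

/-- While the root label increases by at most `l / n`, the hitting probability at growing depth
stays comparable with the expected number of vertices. -/
theorem le_hitProb_add {j : ℕ} {a t δ l : ℝ} (hn : 0 < n) (ha : 0 ≤ a) (ht : 0 ≤ t) (hδ0 : 0 ≤ δ)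
    (hδ1 : δ ≤ 1) (htl : t * Real.exp l ≤ δ) (hj : ∀ x, a ≤ x → x ≤ 1 → t ≤ hitProb n θ j x)
    (i : ℕ) {x : ℝ} (hax : a ≤ x) (hx : x ≤ 1) (hxl : n * (x - a) ≤ l) :
    t * (((1 - δ) * (n * (x - a))) ^ i / i.factorial) ≤ hitProb n θ (j + i) x := by
  induction i generalizing x with
  | zero => simpa using hj x hax hx
  | succ i ih =>
    have hn' : (0 : ℝ) < n := by exact_mod_cast hn
    have hδ : 0 ≤ 1 - δ := by linarith
    have hz : 0 ≤ n * (x - a) := mul_nonneg hn'.le (by linarith)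
    have key := le_hitProb_succ (n := n) h0 h1 (k := j + i) ha hax hx
      (φ := fun y => t * (((1 - δ) * (n * (y - a))) ^ i / i.factorial))
      (Continuous.intervalIntegrable (by fun_prop) _ _) fun y hay hyx =>
        ih hay (hyx.trans hx) (le_trans (by gcongr) hxl)
    have hint : ∫ y in a..x, t * (((1 - δ) * (n * (y - a))) ^ i / i.factorial) =
        (t * (1 - δ) ^ i * ((n * (x - a)) ^ (i + 1) / (i + 1).factorial)) / n := by
      have : ∀ y, t * (((1 - δ) * (n * (y - a))) ^ i / i.factorial) =
          t * (1 - δ) ^ i * n ^ i / i.factorial * (y - a) ^ i := fun y => by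
        rw [mul_pow, mul_pow]; ring
      simp_rw [this]
      rw [intervalIntegral.integral_const_mul,
        intervalIntegral.integral_comp_sub_right (fun y => y ^ i) a, integral_pow,
        Nat.factorial_succ, mul_pow (n : ℝ) (x - a) (i + 1)]
      push_cast
      field_simp
      ring
    rw [hint] at key
    -- A single term of the exponential series is at most `e^l`, so `t e^l ≤ δ` keeps every
    -- generation of the block in the linear regime.
    have hJδ : t * (1 - δ) ^ i * ((n * (x - a)) ^ (i + 1) / (i + 1).factorial) ≤ δ := by
      refine le_trans ?_ htl
      calc _ ≤ t * 1 * Real.exp (n * (x - a)) := by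
            gcongr
            · exact pow_le_one₀ hδ (by linarith)
            · exact Real.pow_div_factorial_le_exp _ hz _
        _ ≤ _ := by rw [mul_one]; gcongr
    refine le_trans (le_of_eq ?_)
      ((mul_le_one_sub_one_sub_div_pow hn (by positivity) hJδ hδ1).trans key)
    rw [mul_pow]
    ring

/-- If the hitting probability grows by a factor `r ≥ 1` whenever the root label grows by `l / n`
and the depth by `k`, then it grows geometrically. -/
theorem pow_mul_le_hitProb {k : ℕ} {δ l r : ℝ} (hn : 0 < n) (hl : 0 ≤ l) (hδ0 : 0 ≤ δ)
    (hδ1 : δ ≤ 1) (hr1 : 1 ≤ r) (hr : r ≤ ((1 - δ) * l) ^ k / k.factorial) (m : ℕ)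
    (hθ : θ * r ^ m * Real.exp l ≤ δ) {x : ℝ} (hmx : m * l / n ≤ x) (hx : x ≤ 1) :
    θ * r ^ m ≤ hitProb n θ (m * k) x := by
  have hn' : (0 : ℝ) < n := by exact_mod_cast hn
  induction m generalizing x with
  | zero => simp [hitProb_zero]
  | succ m ih =>
    have hle : θ * r ^ m ≤ θ * r ^ (m + 1) := by gcongr; omega
    have hθm : θ * r ^ m * Real.exp l ≤ δ := le_trans (by gcongr) hθ
    have hmx' : m * l / n ≤ x - l / n := by
      push_cast at hmx
      rw [add_mul, one_mul, add_div] at hmx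
      linarith
    have hln : n * (x - (x - l / n)) = l := by field_simp; ring
    have := le_hitProb_add h0 h1 (j := m * k) hn (a := x - l / n) (t := θ * r ^ m) (l := l)
      (le_trans (by positivity) hmx') (by positivity) hδ0 hδ1 hθm
      (fun y hay hy => ih hθm (hmx'.trans hay) hy) k (x := x)
      (by have : 0 ≤ l / n := by positivity
          linarith) hx hln.le
    rw [hln, ← Nat.succ_mul] at this
    refine le_trans ?_ this
    rw [pow_succ, ← mul_assoc]
    gcongr

end

/-- Stirling gives `k! ≤ e k (k/e)^k`, and `k (c/e)^k` tends to `0` since `c < e`. -/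
theorem exists_pow_mul_factorial_le {c : ℝ} (hc0 : 0 < c) (hc : c < Real.exp 1) :
    ∃ k : ℕ, 0 < k ∧ c ^ k * k.factorial ≤ (k : ℝ) ^ k := by
  have hq : c / Real.exp 1 < 1 := (div_lt_one (Real.exp_pos 1)).2 hc
  have hlim := tendsto_self_mul_const_pow_of_lt_one (r := c / Real.exp 1) (by positivity) hq
  have hev := (hlim.eventually_lt_const (show (0 : ℝ) < (Real.exp 1)⁻¹ by positivity)).and
    (eventually_gt_atTop 0)
  obtain ⟨k, hk, hk0⟩ := hev.exists
  refine ⟨k, hk0, ?_⟩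
  obtain ⟨j, rfl⟩ := Nat.exists_eq_succ_of_ne_zero hk0.ne'
  have hst : Stirling.stirlingSeq (j + 1) ≤ Stirling.stirlingSeq 1 :=
    Stirling.stirlingSeq'_antitone (Nat.zero_le j)
  rw [Stirling.stirlingSeq_one, Stirling.stirlingSeq, div_le_iff₀ (by positivity)] at hst
  -- Replacing the square root of `k` by `k` is crude, but any polynomial factor is harmless against
  -- `(c/e)^k`.
  have hs : Real.sqrt (2 * (j + 1 : ℕ)) ≤ Real.sqrt 2 * (j + 1 : ℕ) := by
    rw [Real.sqrt_mul (by norm_num)]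
    gcongr
    rw [Real.sqrt_le_left (by positivity)]
    push_cast
    nlinarith [(Nat.cast_nonneg j : (0 : ℝ) ≤ j)]
  have hfac : ((j + 1).factorial : ℝ) ≤
      Real.exp 1 * (j + 1 : ℕ) * ((j + 1 : ℕ) / Real.exp 1) ^ (j + 1) := by
    refine hst.trans ?_
    calc _ ≤ Real.exp 1 / Real.sqrt 2 * (Real.sqrt 2 * (j + 1 : ℕ) *
          ((j + 1 : ℕ) / Real.exp 1) ^ (j + 1)) := by gcongr
      _ = _ := by field_simp
  calc c ^ (j + 1) * ((j + 1).factorial : ℝ)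
      ≤ c ^ (j + 1) * (Real.exp 1 * (j + 1 : ℕ) * ((j + 1 : ℕ) / Real.exp 1) ^ (j + 1)) := by
        gcongr
    _ = Real.exp 1 * ((j + 1 : ℕ) * (c / Real.exp 1) ^ (j + 1)) * ((j + 1 : ℕ) : ℝ) ^ (j + 1) := by
        rw [div_pow, div_pow]; ring
    _ ≤ Real.exp 1 * (Real.exp 1)⁻¹ * ((j + 1 : ℕ) : ℝ) ^ (j + 1) := by gcongr
    _ = _ := by rw [mul_inv_cancel₀ (Real.exp_pos 1).ne', one_mul]

/-- For `b ≤ c < e` the population at depth `m * k + 1` is, with high probability, of order at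
least `(c / b) ^ (m * k)`, as long as `m * k / b` is well below `n * p`. -/
theorem exists_measureReal_levelCount_le {b c : ℝ} (hb : 0 < b) (hbc : b ≤ c)
    (hc : c < Real.exp 1) :
    ∃ k : ℕ, 0 < k ∧ ∃ q : ℝ, 0 < q ∧ ∀ (n m : ℕ) (p s : ℝ), 0 < n → p ≤ 1 → 0 ≤ s →
      m * (k / b) ≤ n * p →
      (labelLaw n).real {u | (levelCount (m * k + 1) p u : ℝ) ≤ s} ≤
        Real.exp (-(q * (n * p - m * (k / b)))) + s * (q / (c / b) ^ (k * m)) := by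
  have hc0 : 0 < c := hb.trans_le hbc
  -- The gap between `c` and `c'` pays for the loss `1 - δ = c/c'` per generation.
  obtain ⟨c', hcc', hc'⟩ := exists_between hc
  have hc'0 : 0 < c' := hc0.trans hcc'
  obtain ⟨k, hk0, hk⟩ := exists_pow_mul_factorial_le hc'0 hc'
  have hcb : 1 ≤ c / b := (one_le_div hb).2 hbc
  let δ : ℝ := 1 - c / c'
  have hδ0 : 0 < δ := sub_pos.2 ((div_lt_one hc'0).2 hcc')
  have hδ1 : δ ≤ 1 := sub_le_self _ (by positivity)
  let l : ℝ := k / b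
  have hl : 0 ≤ l := by positivity
  have hr : (c / b) ^ k ≤ ((1 - δ) * l) ^ k / k.factorial := by
    rw [le_div_iff₀ (by positivity)]
    have : (1 - δ) * l = (c / b / c') * k := by simp only [δ, l]; field_simp; ring
    rw [this, mul_pow]
    calc (c / b) ^ k * (k.factorial : ℝ)
        = (c / b / c') ^ k * (c' ^ k * k.factorial) := by
          rw [div_pow _ c']; field_simp
      _ ≤ _ := by gcongr
  -- This is the largest level with `q e^l ≤ δ`, the limit of the linear regime.
  let q : ℝ := δ * Real.exp (-l)
  have hq0 : 0 < q := by positivity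
  have hq1 : q ≤ 1 := mul_le_one₀ hδ1 (by positivity) (Real.exp_le_one_iff.2 (by linarith))
  refine ⟨k, hk0, q, hq0, fun n m p s hn hp hs hmp => ?_⟩
  have hn' : (0 : ℝ) < n := by exact_mod_cast hn
  let θ : ℝ := q / (c / b) ^ (k * m)
  have hpow : 1 ≤ (c / b) ^ (k * m) := one_le_pow₀ hcb
  have hθ0 : 0 ≤ θ := by positivity
  have hθ1 : θ ≤ 1 := (div_le_self hq0.le hpow).trans hq1
  have hθq : θ * ((c / b) ^ k) ^ m = q := by
    rw [← pow_mul]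
    exact div_mul_cancel₀ _ (by positivity)
  have hmn : m * l / n ≤ p := (div_le_iff₀ hn').2 (by rw [mul_comm p]; exact hmp)
  have hlow : ∀ x, m * l / n ≤ x → x ≤ p → q ≤ hitProb n θ (m * k) x := fun x hx hxp => by
    have := pow_mul_le_hitProb hθ0 hθ1 hn hl hδ0.le hδ1 (one_le_pow₀ hcb) hr m
      (by rw [hθq]; simp only [q]; rw [mul_assoc, ← Real.exp_add]; simp) hx (hxp.trans hp)
    rwa [hθq] at this
  -- The additional generation: a child of the root with label in `[m l / n, p]` has a mark below it
  -- with probability at least `q`, and about `n p - m l` such children are expected.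
  have hsucc := le_hitProb_succ hθ0 hθ1 (show 0 ≤ m * l / n by positivity) hmn hp
    (φ := fun _ => q) (by simp) hlow
  have hexp : (1 - ∫ _ in (m * l / n)..p, q) ^ n ≤ Real.exp (-(q * (n * p - m * l))) := by
    have he : (∫ _ in (m * l / n)..p, q) = q * (n * p - m * l) / n := by
      rw [intervalIntegral.integral_const, smul_eq_mul]
      field_simp
    rw [he]
    refine Real.one_sub_div_pow_le_exp_neg ?_
    have : 0 ≤ m * l := by positivity
    have : n * p ≤ n * 1 := by gcongr
    nlinarith
  have := measureReal_levelCount_le (n := n) hθ0 hθ1 (m * k + 1) p hs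
  linarith

end Percolation

/-! ### Height and size in terms of the level counts -/

section Deterministic

variable {n : ℕ} {x : ℝ} {u : Edge n → ℝ}

theorem levelCount_ne_zero_iff {k : ℕ} :
    levelCount k x u ≠ 0 ↔ ∃ v ∈ tree x u, depth v = k := by
  rw [levelCount, Finset.card_ne_zero]
  exact exists_congr fun v => mem_level

theorem levelCount_ne_zero_of_le {j k : ℕ} (hjk : j ≤ k) (h : levelCount k x u ≠ 0) :
    levelCount j x u ≠ 0 := by
  induction k, hjk using Nat.le_induction with
  | base => exact h
  | succ k _ ih =>
    refine ih ?_
    obtain ⟨v, hv, hd⟩ := levelCount_ne_zero_iff.1 h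
    cases v with
    | nil => simp [depth] at hd
    | cons i w =>
      exact levelCount_ne_zero_iff.2 ⟨w, ((cons_mem_tree x u i w).1 hv).2, by simpa [depth] using hd⟩

open Classical in
theorem tree_subset_of_forall_depth_lt {K : ℕ} (h : ∀ v ∈ tree x u, depth v < K) :
    tree x u ⊆ ((Finset.range K).biUnion fun k => level k x u : Finset (Vertex n)) := fun v hv =>
  Finset.mem_coe.2 (Finset.mem_biUnion.2
    ⟨depth v, Finset.mem_range.2 (h v hv), mem_level.2 ⟨hv, rfl⟩⟩)

theorem finite_tree_of_levelCount_eq_zero {K : ℕ} (h : levelCount K x u = 0) :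
    (tree x u).Finite := by
  classical
  refine (Finset.finite_toSet _).subset (tree_subset_of_forall_depth_lt (K := K) fun v hv => ?_)
  by_contra! hK
  exact levelCount_ne_zero_of_le hK (levelCount_ne_zero_iff.2 ⟨v, hv, rfl⟩) h

theorem depth_le_height (hfin : (tree x u).Finite) {v : Vertex n} (hv : v ∈ tree x u) :
    depth v ≤ height x u :=
  le_csSup (hfin.image depth).bddAbove (Set.mem_image_of_mem _ hv)

theorem le_height_iff (hfin : (tree x u).Finite) {k : ℕ} :
    k ≤ height x u ↔ levelCount k x u ≠ 0 := by
  constructor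
  · intro h
    obtain ⟨v, hv, hd⟩ := Nat.sSup_mem (Set.Nonempty.image depth ⟨_, nil_mem_tree x u⟩)
      (hfin.image depth).bddAbove
    exact levelCount_ne_zero_of_le h (levelCount_ne_zero_iff.2 ⟨v, hv, hd⟩)
  · intro h
    obtain ⟨v, hv, rfl⟩ := levelCount_ne_zero_iff.1 h
    exact depth_le_height hfin hv

theorem levelCount_le_size (hfin : (tree x u).Finite) (k : ℕ) : levelCount k x u ≤ size x u := by
  rw [levelCount, size, ← Set.ncard_coe_finset]
  exact Set.ncard_le_ncard (fun v hv => (mem_level.1 (Finset.mem_coe.1 hv)).1) hfin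

theorem size_pos (hfin : (tree x u).Finite) : 0 < size x u :=
  (Set.ncard_pos hfin).2 ⟨_, nil_mem_tree x u⟩

theorem size_le_tsum_levelCount (hfin : (tree x u).Finite) :
    (size x u : ENNReal) ≤ ∑' k, (levelCount k x u : ENNReal) := by
  classical
  refine le_trans ?_ (ENNReal.sum_le_tsum (Finset.range (height x u + 1)))
  have h := Set.ncard_le_ncard (tree_subset_of_forall_depth_lt (x := x) (u := u) fun v hv =>
    Nat.lt_succ_of_le (depth_le_height hfin hv)) (Finset.finite_toSet _)
  rw [Set.ncard_coe_finset] at h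
  exact_mod_cast h.trans Finset.card_biUnion_le

end Deterministic

/-! ### First moment bounds and finiteness -/

section Moments

variable {p : ℝ}

theorem measurable_levelCount_cast (n k : ℕ) (p : ℝ) :
    Measurable fun u : Edge n → ℝ => (levelCount k p u : ENNReal) :=
  (measurable_from_top (f := fun m : ℕ => (m : ENNReal))).comp (measurable_levelCount_right k p)

theorem lintegral_tsum_levelCount (hp0 : 0 ≤ p) (hp1 : p ≤ 1) (n : ℕ) :
    ∫⁻ u, ∑' k, (levelCount k p u : ENNReal) ∂labelLaw n = ENNReal.ofReal (Real.exp (n * p)) := by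
  rw [lintegral_tsum fun k => (measurable_levelCount_cast n k p).aemeasurable]
  simp_rw [lintegral_levelCount _ hp0 hp1]
  rw [← ENNReal.ofReal_tsum_of_nonneg (fun k => by positivity)
    (Real.summable_pow_div_factorial _), Real.exp_eq_exp_ℝ, NormedSpace.exp_eq_tsum_div]

/-- The level counts have a sum with finite mean, so almost surely these integers eventually vanish,
and an empty level bounds the depth. -/
theorem ae_finite_tree (hp0 : 0 ≤ p) (hp1 : p ≤ 1) (n : ℕ) :
    ∀ᵐ u ∂labelLaw n, (tree p u).Finite := by
  have hm : Measurable fun u : Edge n → ℝ => ∑' k, (levelCount k p u : ENNReal) :=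
    Measurable.tsum fun k => measurable_levelCount_cast n k p
  filter_upwards [ae_lt_top hm (by rw [lintegral_tsum_levelCount hp0 hp1]; simp)] with u hu
  obtain ⟨K, hK⟩ := ((ENNReal.tendsto_atTop_zero_of_tsum_ne_top hu.ne).eventually_lt_const
    zero_lt_one).exists
  exact finite_tree_of_levelCount_eq_zero (K := K) (Nat.lt_one_iff.1 (by exact_mod_cast hK))

theorem measure_levelCount_ne_zero_le (hp0 : 0 ≤ p) (hp1 : p ≤ 1) (n k : ℕ) :
    labelLaw n {u | levelCount k p u ≠ 0} ≤ ENNReal.ofReal ((n * p) ^ k / k.factorial) := by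
  rw [← lintegral_levelCount k hp0 hp1]
  refine le_trans (measure_mono fun u hu => ?_)
    (meas_ge_le_lintegral_div (measurable_levelCount_cast n k p).aemeasurable one_ne_zero
      ENNReal.one_ne_top |>.trans (by rw [div_one]))
  change (1 : ENNReal) ≤ (levelCount k p u : ENNReal)
  exact_mod_cast Nat.one_le_iff_ne_zero.2 hu

end Moments

/-! ### Tails of the height and of the logarithm of the size -/

section Tails

variable {p : ℝ}

theorem tendsto_natCast_mul_atTop (hp0 : 0 < p) :
    Tendsto (fun n : ℕ => (n : ℝ) * p) atTop atTop :=
  tendsto_natCast_atTop_atTop.atTop_mul_const hp0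

theorem tendsto_measure_le_height (hp0 : 0 < p) (hp1 : p ≤ 1) {a : ℝ} (ha : Real.exp 1 < a) :
    Tendsto (fun n => labelLaw n {u | a * (n * p) ≤ height p u}) atTop (𝓝 0) := by
  have ha0 : 0 < a := (Real.exp_pos 1).trans ha
  have hlim : Tendsto (fun n : ℕ => ENNReal.ofReal ((Real.exp 1 / a) ^ ⌈a * (n * p)⌉₊)) atTop
      (𝓝 0) := by
    rw [← ENNReal.ofReal_zero]
    refine ENNReal.tendsto_ofReal ((tendsto_pow_atTop_nhds_zero_of_lt_one (by positivity)
      ((div_lt_one ha0).2 ha)).comp (tendsto_nat_ceil_atTop.comp ?_))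
    exact (tendsto_natCast_mul_atTop hp0).const_mul_atTop ha0
  refine tendsto_of_tendsto_of_tendsto_of_le_of_le tendsto_const_nhds hlim
    (fun _ => zero_le) fun n => ?_
  set K := ⌈a * (n * p)⌉₊ with hK
  have hle : labelLaw n {u | a * (n * p) ≤ height p u} ≤ labelLaw n {u | levelCount K p u ≠ 0} := by
    refine measure_mono_ae ?_
    filter_upwards [ae_finite_tree hp0.le hp1 n] with u hfin hu
    exact (le_height_iff hfin).1 (Nat.ceil_le.2 hu)
  refine hle.trans ((measure_levelCount_ne_zero_le hp0.le hp1 n K).trans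
    (ENNReal.ofReal_le_ofReal ?_))
  have hnp : n * p ≤ K / a := (le_div_iff₀ ha0).2 (by rw [mul_comm]; exact Nat.le_ceil _)
  -- Since `np ≤ K/a` and `K^K / K! ≤ e^K`, the first moment is at most `(e/a)^K`.
  calc ((n : ℝ) * p) ^ K / K.factorial ≤ (K / a) ^ K / K.factorial := by gcongr
    _ = (1 / a) ^ K * ((K : ℝ) ^ K / K.factorial) := by rw [div_pow, div_pow]; ring
    _ ≤ (1 / a) ^ K * Real.exp K := by
        gcongr
        exact Real.pow_div_factorial_le_exp _ (by positivity) _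
    _ = _ := by rw [← Real.exp_one_pow, ← mul_pow]; ring

theorem tendsto_measure_le_log_size (hp0 : 0 < p) (hp1 : p ≤ 1) {a : ℝ} (ha : 1 < a) :
    Tendsto (fun n => labelLaw n {u | a * (n * p) ≤ Real.log (size p u)}) atTop (𝓝 0) := by
  have hlim : Tendsto (fun n : ℕ => ENNReal.ofReal (Real.exp (-((a - 1) * (n * p))))) atTop
      (𝓝 0) := by
    rw [← ENNReal.ofReal_zero]
    exact ENNReal.tendsto_ofReal (Real.tendsto_exp_neg_atTop_nhds_zero.comp
      ((tendsto_natCast_mul_atTop hp0).const_mul_atTop (sub_pos.2 ha)))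
  refine tendsto_of_tendsto_of_tendsto_of_le_of_le tendsto_const_nhds hlim
    (fun _ => zero_le) fun n => ?_
  have hle : labelLaw n {u | a * (n * p) ≤ Real.log (size p u)} ≤
      labelLaw n {u | ENNReal.ofReal (Real.exp (a * (n * p))) ≤
        ∑' k, (levelCount k p u : ENNReal)} := by
    refine measure_mono_ae ?_
    filter_upwards [ae_finite_tree hp0.le hp1 n] with u hfin hu
    refine le_trans ?_ (size_le_tsum_levelCount hfin)
    rw [← ENNReal.ofReal_natCast]
    exact ENNReal.ofReal_le_ofReal
      ((Real.le_log_iff_exp_le (Nat.cast_pos.2 (size_pos hfin))).1 hu)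
  refine hle.trans ((meas_ge_le_lintegral_div (Measurable.aemeasurable
    (Measurable.tsum fun k => measurable_levelCount_cast n k p))
    (by simp [Real.exp_pos]) ENNReal.ofReal_ne_top).trans (le_of_eq ?_))
  rw [lintegral_tsum_levelCount hp0.le hp1, ← ENNReal.ofReal_div_of_pos (Real.exp_pos _),
    ← Real.exp_sub]
  ring_nf

theorem floor_block_bounds {b y : ℝ} {k : ℕ} (hb : 0 < b) (hk : 0 < k) (hy : 0 ≤ y) :
    (⌊y * b / k⌋₊ : ℝ) * (k / b) ≤ y ∧ y * b - k ≤ ⌊y * b / k⌋₊ * k := by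
  have hk' : (0 : ℝ) < k := by exact_mod_cast hk
  have h1 := Nat.floor_le (show 0 ≤ y * b / k by positivity)
  have h2 := (Nat.lt_floor_add_one (y * b / k)).le
  rw [le_div_iff₀ hk'] at h1
  rw [div_le_iff₀ hk'] at h2
  refine ⟨?_, by linarith⟩
  rw [← mul_div_assoc, div_le_iff₀ hb]
  exact h1

theorem tendsto_measure_of_measureReal_le {Ω : ℕ → Type*} [∀ n, MeasurableSpace (Ω n)]
    {P : ∀ n, Measure (Ω n)} [∀ n, IsFiniteMeasure (P n)] {S : ∀ n, Set (Ω n)} {f : ℕ → ℝ}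
    (hf : Tendsto f atTop (𝓝 0)) (h : ∀ᶠ n in atTop, (P n).real (S n) ≤ f n) :
    Tendsto (fun n => P n (S n)) atTop (𝓝 0) := by
  have hr : Tendsto (fun n => (P n).real (S n)) atTop (𝓝 0) :=
    tendsto_of_tendsto_of_tendsto_of_le_of_le' tendsto_const_nhds hf
      (.of_forall fun _ => measureReal_nonneg) h
  simpa using ENNReal.tendsto_ofReal hr

theorem exists_pos_lt_mul {a c : ℝ} (hc : 0 < c) (ha : a < c) :
    ∃ γ η : ℝ, 0 < γ ∧ γ < c ∧ 0 < η ∧ η < 1 ∧ a < γ * η := by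
  obtain ⟨γ, hγ, hγc⟩ := exists_between (max_lt ha hc)
  obtain ⟨haγ, hγ0⟩ := max_lt_iff.1 hγ
  obtain ⟨η, hη, hη1⟩ := exists_between (max_lt ((div_lt_one hγ0).2 haγ) zero_lt_one)
  obtain ⟨haη, hη0⟩ := max_lt_iff.1 hη
  exact ⟨γ, η, hγ0, hγc, hη0, hη1, by rw [mul_comm]; exact (div_lt_iff₀ hγ0).1 haη⟩

theorem tendsto_exp_neg_mul {c : ℝ} (hc : 0 < c) (hp0 : 0 < p) :
    Tendsto (fun n : ℕ => Real.exp (-(c * (n * p)))) atTop (𝓝 0) :=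
  Real.tendsto_exp_neg_atTop_nhds_zero.comp ((tendsto_natCast_mul_atTop hp0).const_mul_atTop hc)

theorem tendsto_measure_height_le (hp0 : 0 < p) (hp1 : p ≤ 1) {a : ℝ} (ha : a < Real.exp 1) :
    Tendsto (fun n => labelLaw n {u | height p u ≤ a * (n * p)}) atTop (𝓝 0) := by
  obtain ⟨c, η, hc0, hc, hη0, hη1, hac⟩ := exists_pos_lt_mul (Real.exp_pos 1) ha
  -- With `b = c` the growth factor is `1`: bare survival is enough, and the depth per unit of `np`
  -- is largest.
  obtain ⟨k, hk, q, hq, hbound⟩ := exists_measureReal_levelCount_le hc0 le_rfl hc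
  refine tendsto_measure_of_measureReal_le
    (tendsto_exp_neg_mul (c := q * (1 - η)) (mul_pos hq (sub_pos.2 hη1)) hp0) ?_
  filter_upwards [eventually_gt_atTop 0,
    ((tendsto_natCast_mul_atTop hp0).const_mul_atTop (sub_pos.2 hac)).eventually_ge_atTop (k : ℝ)]
    with n hn hnk
  have hnp : 0 ≤ n * p := by positivity
  -- The blocks use only the share `η` of the label range; the rest `(1 - η) n p` serves the
  -- additional generation.
  set m := ⌊η * (n * p) * c / k⌋₊
  obtain ⟨hm1, hm2⟩ := floor_block_bounds hc0 hk (mul_nonneg hη0.le hnp)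
  have hb := hbound n m p 0 hn hp1 le_rfl (hm1.trans (mul_le_of_le_one_left hnp hη1.le))
  rw [zero_mul, add_zero] at hb
  refine le_trans ?_ (hb.trans (Real.exp_le_exp.2 ?_))
  · refine ENNReal.toReal_mono (measure_ne_top _ _) (measure_mono_ae ?_)
    filter_upwards [ae_finite_tree hp0.le hp1 n] with u hfin hu
    by_contra h
    have hne : levelCount (m * k + 1) p u ≠ 0 := fun h0 => h (by
      change (levelCount (m * k + 1) p u : ℝ) ≤ 0
      simp [h0])
    have h1 : ((m * k + 1 : ℕ) : ℝ) ≤ height p u := Nat.cast_le.2 ((le_height_iff hfin).2 hne)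
    have h2 : (height p u : ℝ) ≤ a * (n * p) := hu
    push_cast at h1
    linarith
  · rw [mul_assoc q]
    refine neg_le_neg (mul_le_mul_of_nonneg_left ?_ hq.le)
    linarith

theorem tendsto_measure_log_size_le (hp0 : 0 < p) (hp1 : p ≤ 1) {a : ℝ} (ha : a < 1) :
    Tendsto (fun n => labelLaw n {u | Real.log (size p u) ≤ a * (n * p)}) atTop (𝓝 0) := by
  obtain ⟨γ, η, hγ0, hγ1, hη0, hη1, hac⟩ := exists_pos_lt_mul zero_lt_one ha
  -- With `b = 1` and `c = e^γ`, the level at depth about `η n p` has order at least `e^(γ η n p)`,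
  -- which beats `e^(a n p)`.
  obtain ⟨k, hk, q, hq, hbound⟩ := exists_measureReal_levelCount_le zero_lt_one
    (Real.one_le_exp hγ0.le) (Real.exp_lt_exp.2 hγ1)
  have hlim : Tendsto (fun n : ℕ => Real.exp (-(q * (1 - η) * (n * p))) +
      q * Real.exp (γ * k) * Real.exp (-((γ * η - a) * (n * p)))) atTop (𝓝 0) := by
    simpa using (tendsto_exp_neg_mul (c := q * (1 - η)) (mul_pos hq (sub_pos.2 hη1)) hp0).add
      ((tendsto_exp_neg_mul (sub_pos.2 hac) hp0).const_mul (q * Real.exp (γ * k)))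
  refine tendsto_measure_of_measureReal_le hlim ?_
  filter_upwards [eventually_gt_atTop 0] with n hn
  have hnp : 0 ≤ n * p := by positivity
  set m := ⌊η * (n * p) * 1 / k⌋₊
  obtain ⟨hm1, hm2⟩ := floor_block_bounds zero_lt_one hk (mul_nonneg hη0.le hnp)
  have hb := hbound n m p (Real.exp (a * (n * p))) hn hp1 (Real.exp_pos _).le
    (hm1.trans (mul_le_of_le_one_left hnp hη1.le))
  refine le_trans ?_ (hb.trans (add_le_add (Real.exp_le_exp.2 ?_) ?_))
  · refine ENNReal.toReal_mono (measure_ne_top _ _) (measure_mono_ae ?_)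
    filter_upwards [ae_finite_tree hp0.le hp1 n] with u hfin hu
    exact (Nat.cast_le.2 (levelCount_le_size hfin _)).trans
      ((Real.log_le_iff_le_exp (Nat.cast_pos.2 (size_pos hfin))).1 hu)
  · rw [mul_assoc q]
    refine neg_le_neg (mul_le_mul_of_nonneg_left ?_ hq.le)
    linarith
  · rw [div_one, ← Real.exp_nat_mul, div_eq_mul_inv, ← Real.exp_neg, mul_left_comm, mul_assoc q,
      ← Real.exp_add, ← Real.exp_add]
    refine mul_le_mul_of_nonneg_left (Real.exp_le_exp.2 ?_) hq.le
    push_cast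
    nlinarith [mul_le_mul_of_nonneg_left hm2 hγ0.le]

end Tails

/-! ### Convergence in probability -/

section Convergence

variable {Ω : ℕ → Type*} [∀ n, MeasurableSpace (Ω n)] {P : ∀ n, Measure (Ω n)}

theorem tendstoInProbability_of_tails {X : ∀ n, Ω n → ℝ} {c : ℝ}
    (hl : ∀ a < c, Tendsto (fun n => P n {ω | X n ω ≤ a}) atTop (𝓝 0))
    (hu : ∀ a > c, Tendsto (fun n => P n {ω | a ≤ X n ω}) atTop (𝓝 0)) :
    TendstoInProbability P X c := by
  intro ε hε
  have h := (hl (c - ε) (by linarith)).add (hu (c + ε) (by linarith))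
  rw [add_zero] at h
  refine tendsto_of_tendsto_of_tendsto_of_le_of_le tendsto_const_nhds h (fun _ => zero_le)
    fun n => (measure_mono fun ω hω => ?_).trans (measure_union_le _ _)
  rcases le_abs.1 (show ε ≤ |X n ω - c| from hω) with h | h
  · exact Or.inr (show c + ε ≤ X n ω by linarith)
  · exact Or.inl (show X n ω ≤ c - ε by linarith)

theorem TendstoInProbability.congr' {X Y : ∀ n, Ω n → ℝ} {c : ℝ} (h : TendstoInProbability P X c)
    (hXY : ∀ᶠ n in atTop, X n = Y n) : TendstoInProbability P Y c := fun ε hε =>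
  (h ε hε).congr' (hXY.mono fun n hn => by rw [hn])

theorem TendstoInProbability.div {X Y : ∀ n, Ω n → ℝ} {a b : ℝ} (hX : TendstoInProbability P X a)
    (hY : TendstoInProbability P Y b) (hb : b ≠ 0) :
    TendstoInProbability P (fun n ω => X n ω / Y n ω) (a / b) := by
  intro ε hε
  have hc : ContinuousAt (fun z : ℝ × ℝ => z.1 / z.2) (a, b) :=
    continuousAt_fst.div continuousAt_snd hb
  obtain ⟨δ, hδ, hball⟩ := Metric.continuousAt_iff.1 hc ε hε
  have h := (hX δ hδ).add (hY δ hδ)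
  rw [add_zero] at h
  refine tendsto_of_tendsto_of_tendsto_of_le_of_le tendsto_const_nhds h (fun _ => zero_le)
    fun n => (measure_mono fun ω hω => ?_).trans (measure_union_le _ _)
  by_contra hcon
  simp only [Set.mem_union, Set.mem_ofPred_eq, not_or, not_le] at hcon
  have := hball (x := (X n ω, Y n ω)) (max_lt hcon.1 hcon.2)
  exact absurd hω (not_le.2 this)

theorem TendstoInProbability.of_hasLaw {E : ℕ → Type*} [∀ n, MeasurableSpace (E n)]
    {ν : ∀ n, Measure (E n)} {V : ∀ n, Ω n → E n} (hV : ∀ n, HasLaw (V n) (ν n) (P n))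
    {X : ∀ n, E n → ℝ} {c : ℝ} (h : TendstoInProbability ν X c) :
    TendstoInProbability P (fun n ω => X n (V n ω)) c := fun ε hε =>
  tendsto_of_tendsto_of_tendsto_of_le_of_le tendsto_const_nhds (h ε hε) (fun _ => zero_le)
    fun n => by
      rw [← (hV n).map_eq]
      -- This inequality holds for all sets, so no measurability of `X n` is required.
      exact Measure.le_map_apply (hV n).aemeasurable _

end Convergence

/-! ### The limits and their transfer to arbitrary probability spaces -/

variable {p : ℝ}

theorem tendstoInProbability_height (hp0 : 0 < p) (hp1 : p ≤ 1) :
    TendstoInProbability labelLaw (fun n u => (height p u : ℝ) / (n * p)) (Real.exp 1) := by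
  refine tendstoInProbability_of_tails (fun a ha => ?_) fun a ha => ?_
  · refine (tendsto_measure_height_le hp0 hp1 ha).congr' ?_
    filter_upwards [eventually_gt_atTop 0] with n hn
    have : 0 < n * p := by positivity
    simp_rw [div_le_iff₀ this]
  · refine (tendsto_measure_le_height hp0 hp1 ha).congr' ?_
    filter_upwards [eventually_gt_atTop 0] with n hn
    have : 0 < n * p := by positivity
    simp_rw [le_div_iff₀ this]

theorem tendstoInProbability_log_size (hp0 : 0 < p) (hp1 : p ≤ 1) :
    TendstoInProbability labelLaw (fun n u => Real.log (size p u) / (n * p)) 1 := by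
  refine tendstoInProbability_of_tails (fun a ha => ?_) fun a ha => ?_
  · refine (tendsto_measure_log_size_le hp0 hp1 ha).congr' ?_
    filter_upwards [eventually_gt_atTop 0] with n hn
    have : 0 < n * p := by positivity
    simp_rw [div_le_iff₀ this]
  · refine (tendsto_measure_le_log_size hp0 hp1 ha).congr' ?_
    filter_upwards [eventually_gt_atTop 0] with n hn
    have : 0 < n * p := by positivity
    simp_rw [le_div_iff₀ this]

theorem tendstoInProbability_height_div_log_size (hp0 : 0 < p) (hp1 : p ≤ 1) :
    TendstoInProbability labelLaw (fun _ u => (height p u : ℝ) / Real.log (size p u))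
      (Real.exp 1) := by
  have h := (tendstoInProbability_height hp0 hp1).div (tendstoInProbability_log_size hp0 hp1)
    one_ne_zero
  rw [div_one] at h
  refine h.congr' ?_
  filter_upwards [eventually_gt_atTop 0] with _ hn
  funext u
  -- The cancellation needs only `n p ≠ 0`; where `log (size p u) = 0`, both sides are `0` by the
  -- convention for division.
  exact div_div_div_cancel_right₀ (by positivity) _ _

end TemporalTree


theorem theorem2 (p : ℝ) (hp₀ : 0 < p) (hp₁ : p ≤ 1)
    {Ω : ℕ → Type*} [∀ n, MeasurableSpace (Ω n)]
    (P : ∀ n, Measure (Ω n)) [∀ n, IsProbabilityMeasure (P n)]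
    (U : ∀ n, TemporalTree.Edge n → Ω n → ℝ)
    (hU_unif : ∀ n e, HasLaw (U n e) (volume.restrict (Set.Icc (0 : ℝ) 1)) (P n))
    (hU_indep : ∀ n, iIndepFun (U n) (P n)) :
    (∀ n, ∀ᵐ ω ∂(P n), (TemporalTree.tree p (fun e => U n e ω)).Finite) ∧
    TemporalTree.TendstoInProbability P
      (fun n ω => (TemporalTree.height p (fun e => U n e ω) : ℝ) / ((n : ℝ) * p))
      (Real.exp 1) ∧
    TemporalTree.TendstoInProbability P
      (fun n ω => (TemporalTree.height p (fun e => U n e ω) : ℝ) /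
        Real.log (TemporalTree.size p (fun e => U n e ω) : ℝ))
      (Real.exp 1) := by
  have hlaw : ∀ n, HasLaw (fun ω e => U n e ω) (TemporalTree.labelLaw n) (P n) := fun n =>
    (hU_indep n).hasLaw_infinitePi (hU_unif n)
      (aemeasurable_pi_iff.2 fun e => (hU_unif n e).aemeasurable)
  refine ⟨fun n => ?_, ?_, ?_⟩
  · have h := TemporalTree.ae_finite_tree hp₀.le hp₁ n
    rw [← (hlaw n).map_eq] at h
    exact ae_of_ae_map (hlaw n).aemeasurable h
  · exact (TemporalTree.tendstoInProbability_height hp₀ hp₁).of_hasLaw hlaw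
  · exact (TemporalTree.tendstoInProbability_height_div_log_size hp₀ hp₁).of_hasLaw hlaw
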